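/- Let $\gamma\ge 1$ be a real number and let $\mathcal B$ be a non-empty finite set of real numbers with $\beta\ge\gamma$ for all $\beta\in\mathcal B$. Let $a\ge 1/\gamma$, $H=(0,a)$ and $\bar H=[0,a]$. For a positive integer $m$ let $C^m(\bar H)$ be the real Banach space of $C^m$ functions on $\bar H$ (one-sided derivatives at the endpoints; equivalently, $C^m$ functions on $H$ whose derivatives of order $\le m$ extend continuously to $\bar H$), with norm $\|f\|=\max_{0\le k\le m}\sup_{x\in\bar H}|f^{(k)}(x)|$. For $s>0$ define the bounded linear operator $\Lambda_s:C^m(\bar H)\to C^m(\bar H)$ by $$(\Lambda_s f)(x)=\sum_{\beta\in\mathcal B}(x+\beta)^{-2s}\,f\!\left(\frac1{x+\beta}\right),\qquad x\in\bar H.$$ Then $\Lambda_s$ has an eigenvector $v_s\in C^m(\bar H)$ with $v_s(x)>0$ for all $x\in\bar H$ and $\sup_{\bar H}v_s=1$. It is unique: every eigenvector of $\Lambda_s$ (for any real eigenvalue) that is strictly positive on $\bar H$ is a positive constant multiple of $v_s$. Moreover $v_s$ is $C^\infty$ on $\bar H$, and for all integers $\nu\ge1$ and all $x\in\bar H$,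 $$0\le(-1)^\nu\,\frac{v_s^{(\nu)}(x)}{v_s(x)}\le\frac{(2s)(2s+1)\cdots(2s+\nu-1)}{\gamma^\nu}.$$ -/

import Mathlib

open Set
open scoped ContDiff

noncomputable section

namespace PFOperator

/-- Extension by `0` to the whole line of a function on `[0, a]`. Only its values on `[0, a]`
and its derivatives within `[0, a]` (one-sided at the endpoints) are ever used. -/
def zeroExt {a : ℝ} (f : Icc (0 : ℝ) a → ℝ) : ℝ → ℝ :=
  Function.extend Subtype.val f 0

theorem zeroExt_coe {a : ℝ} (f : Icc (0 : ℝ) a → ℝ) (x : Icc (0 : ℝ) a) :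
    zeroExt f x = f x :=
  Subtype.val_injective.extend_apply f 0 x

theorem zeroExt_add {a : ℝ} (f g : Icc (0 : ℝ) a → ℝ) :
    zeroExt (f + g) = zeroExt f + zeroExt g := by
  have h := Function.extend_add (Subtype.val : Icc (0 : ℝ) a → ℝ) f g 0 0
  rw [add_zero] at h
  exact h

theorem zeroExt_smul {a : ℝ} (c : ℝ) (f : Icc (0 : ℝ) a → ℝ) :
    zeroExt (c • f) = c • zeroExt f := by
  have h := Function.extend_smul c (Subtype.val : Icc (0 : ℝ) a → ℝ) f 0
  rw [smul_zero] at h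
  exact h

theorem zeroExt_zero {a : ℝ} : zeroExt (0 : Icc (0 : ℝ) a → ℝ) = 0 := by
  have h := zeroExt_smul (0 : ℝ) (0 : Icc (0 : ℝ) a → ℝ)
  simpa using h

/-- The real functions on `[0, a]` that are `C^m` on `[0, a]` (one-sided derivatives at the
endpoints); equivalently, the `C^m` functions on `(0, a)` all of whose derivatives of order at
most `m` extend continuously to `[0, a]`. -/
def cmSubmodule (a : ℝ) (m : ℕ) : Submodule ℝ (Icc (0 : ℝ) a → ℝ) where
  carrier := {f | ContDiffOn ℝ m (zeroExt f) (Icc 0 a)}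
  add_mem' {f g} hf hg := by
    simp only [mem_ofPred_eq, zeroExt_add] at *
    exact hf.add hg
  zero_mem' := by
    simp only [mem_ofPred_eq, zeroExt_zero]
    exact contDiffOn_const
  smul_mem' c f hf := by
    simp only [mem_ofPred_eq, zeroExt_smul] at *
    exact hf.const_smul c

/-- The space `C^m([0, a])`, `a > 0`, as a type of its own, with the norm defined below. -/
def CmSpace (a : ℝ) (_ha : 0 < a) (m : ℕ) : Type := cmSubmodule a m

variable {a : ℝ} {ha : 0 < a} {m : ℕ}

instance : AddCommGroup (CmSpace a ha m) := inferInstanceAs (AddCommGroup (cmSubmodule a m))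

instance : Module ℝ (CmSpace a ha m) := inferInstanceAs (Module ℝ (cmSubmodule a m))

instance : CoeFun (CmSpace a ha m) (fun _ => Icc (0 : ℝ) a → ℝ) := ⟨fun f => f.1⟩

/-- The `k`-th derivative of `f` on `[0, a]` (one-sided at the endpoints). -/
def nthDeriv (k : ℕ) (f : Icc (0 : ℝ) a → ℝ) (x : Icc (0 : ℝ) a) : ℝ :=
  iteratedDerivWithin k (zeroExt f) (Icc 0 a) x

/-- The derivatives of orders `0, …, m` of an element of `C^m([0, a])`, as a tuple of continuous
functions on `[0, a]`. -/
def jet (a : ℝ) (ha : 0 < a) (m : ℕ) : CmSpace a ha m →ₗ[ℝ] (Fin (m + 1) → C(Icc (0 : ℝ) a, ℝ)) where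
  toFun f k := ⟨nthDeriv k f.1, by
    have h : ContDiffOn ℝ m (zeroExt f.1) (Icc 0 a) := f.2
    exact (h.continuousOn_iteratedDerivWithin (by exact_mod_cast Nat.lt_succ_iff.1 k.2)
      (uniqueDiffOn_Icc ha)).domRestrict⟩
  map_add' f g := by
    ext k x
    have hk : ((k : ℕ) : ℕ∞ω) ≤ (m : ℕ∞ω) := by exact_mod_cast Nat.lt_succ_iff.1 k.2
    have hf : ContDiffOn ℝ m (zeroExt f.1) (Icc 0 a) := f.2
    have hg : ContDiffOn ℝ m (zeroExt g.1) (Icc 0 a) := g.2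
    change iteratedDerivWithin k (zeroExt (f.1 + g.1)) (Icc 0 a) x = _
    rw [zeroExt_add, iteratedDerivWithin_add x.2 (uniqueDiffOn_Icc ha)
      ((hf x x.2).of_le hk) ((hg x x.2).of_le hk)]
    rfl
  map_smul' c f := by
    ext k x
    change iteratedDerivWithin k (zeroExt (c • f.1)) (Icc 0 a) x = _
    rw [zeroExt_smul, iteratedDerivWithin_const_smul_field]
    rfl

theorem jet_injective : Function.Injective (jet a ha m) := by
  intro f g h
  refine Subtype.ext (funext fun x => ?_)
  have h0 := DFunLike.congr_fun (congrFun h 0) x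
  change iteratedDerivWithin 0 (zeroExt f.1) (Icc 0 a) x
    = iteratedDerivWithin 0 (zeroExt g.1) (Icc 0 a) x at h0
  simpa only [iteratedDerivWithin_zero, zeroExt_coe] using h0

/-- The norm of `C^m([0, a])`: the maximum over `k ≤ m` of the sup norm of the `k`-th
derivative. -/
instance : NormedAddCommGroup (CmSpace a ha m) :=
  NormedAddCommGroup.induced _ _ (jet a ha m) jet_injective

instance : NormedSpace ℝ (CmSpace a ha m) :=
  NormedSpace.induced ℝ (CmSpace a ha m) (Fin (m + 1) → C(Icc (0 : ℝ) a, ℝ)) (jet a ha m)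

theorem abs_nthDeriv_le (f : CmSpace a ha m) {k : ℕ} (hk : k ≤ m) (x : Icc (0 : ℝ) a) :
    |nthDeriv k f.1 x| ≤ ‖f‖ := by
  have h1 := norm_le_pi_norm (jet a ha m f) ⟨k, Nat.lt_succ_of_le hk⟩
  exact (ContinuousMap.norm_coe_le_norm (jet a ha m f ⟨k, Nat.lt_succ_of_le hk⟩) x).trans h1

theorem norm_le_of_abs_nthDeriv_le (f : CmSpace a ha m) {C : ℝ} (hC : 0 ≤ C)
    (h : ∀ k ≤ m, ∀ x, |nthDeriv k f.1 x| ≤ C) : ‖f‖ ≤ C := by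
  refine (pi_norm_le_iff_of_nonneg hC).2 fun k => ?_
  refine (ContinuousMap.norm_le _ hC).2 fun x => ?_
  exact h k (Nat.lt_succ_iff.1 k.2) x

/-- The inverse branches `x ↦ 1 / (x + β)`, `β ∈ B`, are defined on `[0, a]` and map it into
itself. -/
def Admissible (a : ℝ) (B : Finset ℝ) : Prop :=
  ∀ β ∈ B, 0 < β ∧ 1 / β ≤ a

theorem Admissible.of_le {γ : ℝ} (hγ : 1 ≤ γ) {B : Finset ℝ} (hB : ∀ β ∈ B, γ ≤ β)
    {a : ℝ} (ha : 1 / γ ≤ a) : Admissible a B := fun β hβ => by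
  have hγ0 : 0 < γ := by linarith
  exact ⟨hγ0.trans_le (hB β hβ), (one_div_le_one_div_of_le hγ0 (hB β hβ)).trans ha⟩

theorem Admissible.branch_mem {B : Finset ℝ} (hB : Admissible a B) {β : ℝ} (hβ : β ∈ B)
    {x : ℝ} (hx : x ∈ Icc (0 : ℝ) a) : 1 / (x + β) ∈ Icc (0 : ℝ) a := by
  obtain ⟨h0, h1⟩ := hB β hβ
  have hx0 : 0 ≤ x := hx.1
  exact ⟨by positivity, (one_div_le_one_div_of_le h0 (by linarith)).trans h1⟩

/-- The formula `(Λ_s f)(x) = ∑_{β ∈ B} (x + β)^{-2s} f(1 / (x + β))` for `x ∈ [0, a]`. -/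
def transferFun {B : Finset ℝ} (hB : Admissible a B) (s : ℝ) (f : Icc (0 : ℝ) a → ℝ)
    (x : Icc (0 : ℝ) a) : ℝ :=
  ∑ β ∈ B.attach, ((x : ℝ) + β) ^ (-(2 * s)) * f ⟨1 / ((x : ℝ) + β), hB.branch_mem β.2 x.2⟩

theorem zeroExt_transferFun {B : Finset ℝ} (hB : Admissible a B) (s : ℝ)
    (f : Icc (0 : ℝ) a → ℝ) :
    EqOn (zeroExt (transferFun hB s f))
      (fun x => ∑ β ∈ B, (x + β) ^ (-(2 * s)) * (zeroExt f ∘ fun x => 1 / (x + β)) x)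
      (Icc 0 a) := by
  intro x hx
  have h := zeroExt_coe (transferFun hB s f) ⟨x, hx⟩
  simp only at h
  rw [h, transferFun]
  beta_reduce
  rw [← Finset.sum_attach B]
  refine Finset.sum_congr rfl fun β _ => ?_
  rw [Function.comp_apply, ← zeroExt_coe f]

theorem contDiffOn_weight {B : Finset ℝ} (hB : Admissible a B) (s : ℝ) {β : ℝ} (hβ : β ∈ B)
    (n : ℕ∞ω) : ContDiffOn ℝ n (fun x : ℝ => (x + β) ^ (-(2 * s))) (Icc 0 a) := by
  have h0 := (hB β hβ).1
  exact (contDiff_id.add contDiff_const).contDiffOn.rpow_const_of_ne fun x hx =>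
    (by have := hx.1; simp only [id]; linarith : (0 : ℝ) < id x + β).ne'

theorem contDiffOn_branch {B : Finset ℝ} (hB : Admissible a B) {β : ℝ} (hβ : β ∈ B)
    (n : ℕ∞ω) : ContDiffOn ℝ n (fun x : ℝ => 1 / (x + β)) (Icc 0 a) := by
  have h0 := (hB β hβ).1
  exact contDiff_const.contDiffOn.div (contDiff_id.add contDiff_const).contDiffOn fun x hx =>
    (by have := hx.1; simp only [id]; linarith : (0 : ℝ) < id x + β).ne'

theorem contDiffOn_term {B : Finset ℝ} (hB : Admissible a B) (s : ℝ) {β : ℝ} (hβ : β ∈ B)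
    (f : CmSpace a ha m) : ContDiffOn ℝ m
      (fun x => (x + β) ^ (-(2 * s)) * (zeroExt f.1 ∘ fun x => 1 / (x + β)) x) (Icc 0 a) := by
  have hf : ContDiffOn ℝ m (zeroExt f.1) (Icc 0 a) := f.2
  exact (contDiffOn_weight hB s hβ _).mul
    (hf.comp (contDiffOn_branch hB hβ _) fun x hx => hB.branch_mem hβ hx)

theorem transferFun_mem {B : Finset ℝ} (hB : Admissible a B) (s : ℝ) (f : CmSpace a ha m) :
    transferFun hB s f.1 ∈ cmSubmodule a m := by
  refine ContDiffOn.congr ?_ (zeroExt_transferFun hB s f.1)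
  exact ContDiffOn.sum fun β hβ => contDiffOn_term hB s hβ f

/-- `Λ_s` as a linear map of `C^m([0, a])` into itself. -/
def transferLin (ha : 0 < a) (m : ℕ) {B : Finset ℝ} (hB : Admissible a B) (s : ℝ) :
    CmSpace a ha m →ₗ[ℝ] CmSpace a ha m where
  toFun f := ⟨transferFun hB s f.1, transferFun_mem hB s f⟩
  map_add' f g := by
    refine Subtype.ext (funext fun x => ?_)
    change transferFun hB s (f.1 + g.1) x = transferFun hB s f.1 x + transferFun hB s g.1 x
    simp only [transferFun, Pi.add_apply, mul_add, Finset.sum_add_distrib]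
  map_smul' c f := by
    refine Subtype.ext (funext fun x => ?_)
    change transferFun hB s (c • f.1) x = c * transferFun hB s f.1 x
    simp only [transferFun, Pi.smul_apply, smul_eq_mul, Finset.mul_sum]
    exact Finset.sum_congr rfl fun β _ => by ring

theorem exists_deriv_bound (ha : 0 < a) (m : ℕ) {g : ℝ → ℝ} (hg : ContDiffOn ℝ m g (Icc 0 a)) :
    ∃ C : ℝ, 1 ≤ C ∧ ∀ k ≤ m, ∀ x ∈ Icc (0 : ℝ) a,
      ‖iteratedFDerivWithin ℝ k g (Icc 0 a) x‖ ≤ C := by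
  have h : ∀ k, ∃ C : ℝ, k ≤ m → ∀ x ∈ Icc (0 : ℝ) a,
      ‖iteratedFDerivWithin ℝ k g (Icc 0 a) x‖ ≤ C := fun k => by
    by_cases hk : k ≤ m
    · obtain ⟨C, hC⟩ := isCompact_Icc.exists_bound_of_continuousOn
        (hg.continuousOn_iteratedFDerivWithin (by exact_mod_cast hk) (uniqueDiffOn_Icc ha))
      exact ⟨C, fun _ => hC⟩
    · exact ⟨0, fun h => absurd h hk⟩
  choose C hC using h
  refine ⟨1 + ∑ k ∈ Finset.range (m + 1), |C k|, ?_, fun k hk x hx => ?_⟩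
  · have : 0 ≤ ∑ k ∈ Finset.range (m + 1), |C k| := Finset.sum_nonneg fun _ _ => abs_nonneg _
    linarith
  · have h1 : |C k| ≤ ∑ k ∈ Finset.range (m + 1), |C k| :=
      Finset.single_le_sum (f := fun k => |C k|) (fun _ _ => abs_nonneg _)
        (Finset.mem_range.2 (Nat.lt_succ_of_le hk))
    linarith [hC k hk x hx, le_abs_self (C k)]

theorem exists_term_bound (ha : 0 < a) (m : ℕ) {B : Finset ℝ} (hB : Admissible a B) (s : ℝ)
    {β : ℝ} (hβ : β ∈ B) : ∃ C : ℝ, 0 ≤ C ∧ ∀ f : CmSpace a ha m, ∀ k ≤ m,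
      ∀ x ∈ Icc (0 : ℝ) a, |iteratedDerivWithin k
        (fun x => (x + β) ^ (-(2 * s)) * (zeroExt f.1 ∘ fun x => 1 / (x + β)) x)
        (Icc 0 a) x| ≤ C * ‖f‖ := by
  obtain ⟨W, hW1, hW⟩ := exists_deriv_bound ha m (contDiffOn_weight hB s hβ m)
  obtain ⟨D, hD1, hD⟩ := exists_deriv_bound ha m (contDiffOn_branch hB hβ m)
  have hu := uniqueDiffOn_Icc ha
  refine ⟨∑ k ∈ Finset.range (m + 1), ∑ i ∈ Finset.range (k + 1),
    (k.choose i : ℝ) * W * (Nat.factorial (k - i) * D ^ (k - i)), by positivity,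
    fun f k hk x hx => ?_⟩
  have hf : ContDiffOn ℝ m (zeroExt f.1) (Icc 0 a) := f.2
  have hmaps : MapsTo (fun x : ℝ => 1 / (x + β)) (Icc 0 a) (Icc 0 a) :=
    fun x hx => hB.branch_mem hβ hx
  rw [← Real.norm_eq_abs, ← norm_iteratedFDerivWithin_eq_norm_iteratedDerivWithin]
  refine (norm_iteratedFDerivWithin_mul_le (contDiffOn_weight hB s hβ m)
    (hf.comp (contDiffOn_branch hB hβ _) hmaps) hu hx (by exact_mod_cast hk)).trans ?_
  have key : ∀ i ∈ Finset.range (k + 1),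
      (k.choose i : ℝ) * ‖iteratedFDerivWithin ℝ i (fun x : ℝ => (x + β) ^ (-(2 * s))) (Icc 0 a) x‖
        * ‖iteratedFDerivWithin ℝ (k - i) (zeroExt f.1 ∘ fun x => 1 / (x + β)) (Icc 0 a) x‖
      ≤ (k.choose i : ℝ) * W * (Nat.factorial (k - i) * D ^ (k - i)) * ‖f‖ := by
    intro i hi
    have hi' : i ≤ k := Nat.lt_succ_iff.1 (Finset.mem_range.1 hi)
    have h2 : ‖iteratedFDerivWithin ℝ (k - i) (zeroExt f.1 ∘ fun x => 1 / (x + β)) (Icc 0 a) x‖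
        ≤ Nat.factorial (k - i) * ‖f‖ * D ^ (k - i) := by
      refine norm_iteratedFDerivWithin_comp_le hf (contDiffOn_branch hB hβ m)
        (by exact_mod_cast (Nat.sub_le k i).trans hk) hu hu hmaps hx (fun j hj => ?_)
        (fun j hj1 hj => ?_)
      · rw [norm_iteratedFDerivWithin_eq_norm_iteratedDerivWithin]
        exact abs_nthDeriv_le f (hj.trans ((Nat.sub_le k i).trans hk)) ⟨_, hmaps hx⟩
      · exact (hD j (hj.trans ((Nat.sub_le k i).trans hk)) x hx).trans
          (le_self_pow₀ hD1 (by omega))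
    have h1 := hW i (hi'.trans hk) x hx
    calc _ ≤ (k.choose i : ℝ) * W * (Nat.factorial (k - i) * ‖f‖ * D ^ (k - i)) := by gcongr
      _ = _ := by ring
  refine (Finset.sum_le_sum key).trans ?_
  rw [← Finset.sum_mul]
  refine mul_le_mul_of_nonneg_right ?_ (norm_nonneg _)
  exact Finset.single_le_sum (f := fun k : ℕ => ∑ i ∈ Finset.range (k + 1),
    (k.choose i : ℝ) * W * (Nat.factorial (k - i) * D ^ (k - i)))
    (fun k _ => by positivity) (Finset.mem_range.2 (Nat.lt_succ_of_le hk))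

theorem transferLin_bound (ha : 0 < a) (m : ℕ) {B : Finset ℝ} (hB : Admissible a B) (s : ℝ) :
    ∃ C : ℝ, ∀ f : CmSpace a ha m, ‖transferLin ha m hB s f‖ ≤ C * ‖f‖ := by
  have h : ∀ β : B, ∃ C : ℝ, 0 ≤ C ∧ ∀ f : CmSpace a ha m, ∀ k ≤ m,
      ∀ x ∈ Icc (0 : ℝ) a, |iteratedDerivWithin k
        (fun x => (x + β.1) ^ (-(2 * s)) * (zeroExt f.1 ∘ fun x => 1 / (x + β.1)) x)
        (Icc 0 a) x| ≤ C * ‖f‖ := fun β => exists_term_bound ha m hB s β.2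
  choose C hC0 hC using h
  refine ⟨∑ β ∈ B.attach, C β, fun f => norm_le_of_abs_nthDeriv_le _
    (mul_nonneg (Finset.sum_nonneg fun β _ => hC0 β) (norm_nonneg f)) fun k hk x => ?_⟩
  change |iteratedDerivWithin k (zeroExt (transferFun hB s f.1)) (Icc 0 a) x| ≤ _
  rw [iteratedDerivWithin_congr (zeroExt_transferFun hB s f.1) x.2]
  simp_rw [← Finset.sum_attach B]
  rw [iteratedDerivWithin_fun_sum x.2 (uniqueDiffOn_Icc ha) fun β _ =>
    (contDiffOn_term hB s β.2 f x x.2).of_le (by exact_mod_cast hk), Finset.sum_mul]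
  exact (Finset.abs_sum_le_sum_abs _ _).trans
    (Finset.sum_le_sum fun β _ => hC β f k hk x x.2)

/-- The bounded linear operator `Λ_s : C^m([0, a]) → C^m([0, a])`,
`(Λ_s f)(x) = ∑_{β ∈ B} (x + β)^{-2s} f(1 / (x + β))`. -/
def transferOp (ha : 0 < a) (m : ℕ) {B : Finset ℝ} (hB : Admissible a B) (s : ℝ) :
    CmSpace a ha m →L[ℝ] CmSpace a ha m :=
  ⟨transferLin ha m hB s, by
    obtain ⟨C, hC⟩ := transferLin_bound ha m hB s
    exact AddMonoidHomClass.continuous_of_bound (transferLin ha m hB s) C hC⟩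

theorem transferOp_apply (ha : 0 < a) (m : ℕ) {B : Finset ℝ} (hB : Admissible a B) (s : ℝ)
    (f : CmSpace a ha m) (x : Icc (0 : ℝ) a) :
    transferOp ha m hB s f x = ∑ β ∈ B.attach,
      ((x : ℝ) + β) ^ (-(2 * s)) * f ⟨1 / ((x : ℝ) + β), hB.branch_mem β.2 x.2⟩ := rfl

/-- `v` is a strictly positive eigenvector of `T`: an eigenvector, for some real eigenvalue, with
`v > 0` on all of `[0, a]`. -/
def IsStrictlyPosEigenvector (T : CmSpace a ha m →L[ℝ] CmSpace a ha m)
    (v : CmSpace a ha m) : Prop :=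
  (∃ r : ℝ, Module.End.HasEigenvector (T : CmSpace a ha m →ₗ[ℝ] CmSpace a ha m) r v) ∧
    ∀ x, 0 < v x

/-- `v` is normalized: its supremum over `[0, a]` is `1`. -/
def IsNormalized (v : CmSpace a ha m) : Prop := IsLUB (range v) 1

/-- `v` is infinitely differentiable on `[0, a]`. -/
def IsSmooth (v : CmSpace a ha m) : Prop := ContDiffOn ℝ ∞ (zeroExt v) (Icc 0 a)

end PFOperator

end

/-! The functions `x ↦ (1 + t x)^{-2s}` with `0 ≤ t ≤ 1 / γ` span a cone that `Λ_s` maps into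
itself: the branch `β` sends such a function to `(x + β + t)^{-2s}`, a multiple of the one with
parameter `1 / (β + t) ≤ 1 / γ`. Each generator satisfies the asserted derivative bounds and a
Harnack inequality on `[0, a]`, and these are linear or convex homogeneous conditions, so they hold
on the whole cone and survive pointwise limits.

Existence: the Harnack inequality makes `b n = (Λ_s^n 1)(0)` multiplicative up to a constant, hence
comparable to `r ^ n` for some `r > 0` (`exists_rate`). The averages of `r ^ (-n) Λ_s^n 1`, taken
with all their derivatives, lie in a compact set (`isCompact_jetBounds`), and every limit point is
an eigenfunction for `r` (`exists_eigenJet`). A uniform Taylor estimate ensures that the limits of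
the derivatives are the derivatives of the limit.

Uniqueness: for two positive eigenfunctions, the quotient is constant along the orbit of a branch
that starts at its minimum, and likewise at its maximum. Two such orbits approach each other, so
minimum and maximum agree (`eq_smul_of_positive_eigenfunctions`). -/

namespace PFOperator

open Filter Topology
open scoped NNReal

/-! ### Generating functions `(1 + t x)^{-2s}` and their derivatives -/

/-- The `ν`-th derivative of `x ↦ (1 + t x)^{-2s}`. -/
noncomputable def genDeriv (s t : ℝ) (ν : ℕ) (x : ℝ) : ℝ :=
  (-1) ^ ν * (∏ i ∈ Finset.range ν, (2 * s + i)) * t ^ ν * (1 + t * x) ^ (-(2 * s) - ν)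

/-- The constant `(2s)(2s+1)⋯(2s+ν-1) / γ^ν`. -/
noncomputable def derivConst (s γ : ℝ) (ν : ℕ) : ℝ :=
  (∏ i ∈ Finset.range ν, (2 * s + i)) / γ ^ ν

theorem prod_nonneg_of_pos {s : ℝ} (hs : 0 < s) (ν : ℕ) :
    0 ≤ ∏ i ∈ Finset.range ν, (2 * s + (i : ℝ)) :=
  Finset.prod_nonneg fun _ _ => by positivity

theorem derivConst_nonneg {s γ : ℝ} (hs : 0 < s) (hγ : 1 ≤ γ) (ν : ℕ) :
    0 ≤ derivConst s γ ν :=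
  div_nonneg (prod_nonneg_of_pos hs ν) (by positivity)

theorem genDeriv_zero (s t x : ℝ) : genDeriv s t 0 x = (1 + t * x) ^ (-(2 * s)) := by
  simp [genDeriv]

theorem hasDerivAt_genDeriv (s : ℝ) {t x : ℝ} (h : 0 < 1 + t * x) (ν : ℕ) :
    HasDerivAt (genDeriv s t ν) (genDeriv s t (ν + 1) x) x := by
  have h1 : HasDerivAt (fun y : ℝ => 1 + t * y) t x := by
    simpa using ((hasDerivAt_id x).const_mul t).const_add 1
  have h2 := (h1.rpow_const (p := -(2 * s) - ν) (Or.inl h.ne')).const_mul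
    ((-1) ^ ν * (∏ i ∈ Finset.range ν, (2 * s + i)) * t ^ ν)
  refine h2.congr_deriv ?_
  rw [genDeriv, Finset.prod_range_succ]
  have h3 : -(2 * s) - ((ν + 1 : ℕ) : ℝ) = -(2 * s) - ν - 1 := by push_cast; ring
  rw [h3]
  ring

theorem neg_one_pow_mul_genDeriv (s t : ℝ) (ν : ℕ) (x : ℝ) :
    (-1) ^ ν * genDeriv s t ν x =
      (∏ i ∈ Finset.range ν, (2 * s + i)) * t ^ ν * (1 + t * x) ^ (-(2 * s) - ν) := by
  have : ((-1 : ℝ) ^ ν) * (-1) ^ ν = 1 := by rw [← mul_pow]; simp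
  rw [genDeriv, ← mul_assoc, ← mul_assoc, ← mul_assoc, this, one_mul]

theorem genDeriv_sign {s t x : ℝ} (hs : 0 < s) (ht : 0 ≤ t) (hx : 0 ≤ x) (ν : ℕ) :
    0 ≤ (-1) ^ ν * genDeriv s t ν x := by
  rw [neg_one_pow_mul_genDeriv]
  have := prod_nonneg_of_pos hs ν
  positivity

/-- Differentiating `ν` times brings out `t ^ ν ≤ 1 / γ ^ ν` and an extra factor `(1 + t x)^{-ν} ≤
1`. -/
theorem genDeriv_bound {s γ t x : ℝ} (hs : 0 < s) (hγ : 1 ≤ γ) (ht : 0 ≤ t) (htγ : t ≤ 1 / γ)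
    (hx : 0 ≤ x) (ν : ℕ) :
    (-1) ^ ν * genDeriv s t ν x ≤ derivConst s γ ν * genDeriv s t 0 x := by
  rw [neg_one_pow_mul_genDeriv, genDeriv_zero, derivConst]
  have h0 := prod_nonneg_of_pos hs ν
  have h1 : (1 + t * x) ^ (-(2 * s) - ν) ≤ (1 + t * x) ^ (-(2 * s)) :=
    Real.rpow_le_rpow_of_exponent_le (by nlinarith) (by linarith [Nat.cast_nonneg (α := ℝ) ν])
  have h2 : t ^ ν ≤ 1 / γ ^ ν := by
    rw [← one_div_pow]; exact pow_le_pow_left₀ ht htγ ν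
  rw [div_eq_mul_one_div]
  gcongr

theorem genDeriv_zero_le_one {s t x : ℝ} (hs : 0 < s) (ht : 0 ≤ t) (hx : 0 ≤ x) :
    genDeriv s t 0 x ≤ 1 := by
  rw [genDeriv_zero]
  exact Real.rpow_le_one_of_one_le_of_nonpos (by nlinarith [mul_nonneg ht hx]) (by linarith)

theorem abs_genDeriv_le {s γ t x : ℝ} (hs : 0 < s) (hγ : 1 ≤ γ) (ht : 0 ≤ t) (htγ : t ≤ 1 / γ)
    (hx : 0 ≤ x) (ν : ℕ) : |genDeriv s t ν x| ≤ derivConst s γ ν := by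
  have h1 := genDeriv_sign hs ht hx ν
  have h2 := genDeriv_bound hs hγ ht htγ hx ν
  have h3 : |genDeriv s t ν x| = |(-1) ^ ν * genDeriv s t ν x| := by
    simp [abs_mul]
  rw [h3, abs_of_nonneg h1]
  exact h2.trans (mul_le_of_le_one_right (derivConst_nonneg hs hγ ν)
    (genDeriv_zero_le_one hs ht hx))

theorem abs_genDeriv_sub_le {s γ t x y : ℝ} (hs : 0 < s) (hγ : 1 ≤ γ) (ht : 0 ≤ t)
    (htγ : t ≤ 1 / γ) (hx : 0 ≤ x) (hy : 0 ≤ y) (ν : ℕ) :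
    |genDeriv s t ν y - genDeriv s t ν x| ≤ derivConst s γ (ν + 1) * |y - x| := by
  have := (convex_Ici (0 : ℝ)).norm_image_sub_le_of_norm_hasDerivWithin_le
    (f := genDeriv s t ν) (f' := genDeriv s t (ν + 1)) (C := derivConst s γ (ν + 1))
    (fun z (hz : 0 ≤ z) => (hasDerivAt_genDeriv s (by positivity) ν).hasDerivWithinAt)
    (fun z hz => abs_genDeriv_le hs hγ ht htγ hz _) hx hy
  simpa only [Real.norm_eq_abs] using this

/-- Mean value inequality for the function minus its linear part at `x`, on the interval between `x`
and `y`. The constant is uniform in `t`; its sharp value is irrelevant. -/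
theorem abs_genDeriv_taylor_le {s γ t x y : ℝ} (hs : 0 < s) (hγ : 1 ≤ γ) (ht : 0 ≤ t)
    (htγ : t ≤ 1 / γ) (hx : 0 ≤ x) (hy : 0 ≤ y) (ν : ℕ) :
    |genDeriv s t ν y - genDeriv s t ν x - (y - x) * genDeriv s t (ν + 1) x|
      ≤ derivConst s γ (ν + 2) * (y - x) ^ 2 := by
  have hsub : uIcc x y ⊆ Ici 0 := fun z hz => (le_min hx hy).trans hz.1
  have := (convex_uIcc x y).norm_image_sub_le_of_norm_hasDerivWithin_le
    (f := fun z => genDeriv s t ν z - z * genDeriv s t (ν + 1) x)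
    (f' := fun z => genDeriv s t (ν + 1) z - 1 * genDeriv s t (ν + 1) x)
    (C := derivConst s γ (ν + 2) * |y - x|)
    (fun z hz => by
      have hz0 : 0 ≤ z := hsub hz
      exact ((hasDerivAt_genDeriv s (by positivity) ν).sub
        ((hasDerivAt_id z).mul_const _)).hasDerivWithinAt)
    (fun z hz => by
      rw [one_mul]
      refine (abs_genDeriv_sub_le hs hγ ht htγ hx (hsub hz) (ν + 1)).trans ?_
      exact mul_le_mul_of_nonneg_left (abs_sub_left_of_mem_uIcc hz)
        (derivConst_nonneg hs hγ _))
    left_mem_uIcc right_mem_uIcc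
  simp only [Real.norm_eq_abs] at this
  rw [mul_assoc, abs_mul_abs_self] at this
  calc _ = |genDeriv s t ν y - y * genDeriv s t (ν + 1) x -
        (genDeriv s t ν x - x * genDeriv s t (ν + 1) x)| := by congr 1; ring
    _ ≤ _ := by rwa [sq]

/-! ### Closed convex conditions on tuples of derivatives -/

/-- The bounds satisfied by the tuple of derivatives of a positive combination of functions
`x ↦ (1 + t x)^{-2s}`, `0 ≤ t ≤ 1 / γ`. They are preserved by pointwise limits. -/
structure JetBounds {a : ℝ} (ha : 0 < a) (s γ : ℝ) (F : ℕ → Icc (0 : ℝ) a → ℝ) : Prop where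
  sign : ∀ ν x, 0 ≤ (-1) ^ ν * F ν x
  bound : ∀ ν x, (-1) ^ ν * F ν x ≤ derivConst s γ ν * F 0 x
  lower : ∀ x, (1 + a) ^ (-(2 * s)) * F 0 ⟨0, le_rfl, ha.le⟩ ≤ F 0 x
  upper : ∀ x, F 0 x ≤ F 0 ⟨0, le_rfl, ha.le⟩
  taylor : ∀ ν (x y : Icc (0 : ℝ) a), |F ν y - F ν x - ((y : ℝ) - x) * F (ν + 1) x|
    ≤ derivConst s γ (ν + 2) * ((y : ℝ) - x) ^ 2 * F 0 ⟨0, le_rfl, ha.le⟩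

variable {a : ℝ} {ha : 0 < a} {s γ : ℝ}

theorem JetBounds.gen (hs : 0 < s) (hγ : 1 ≤ γ) {t : ℝ} (ht : 0 ≤ t) (htγ : t ≤ 1 / γ) :
    JetBounds ha s γ fun ν x => genDeriv s t ν x := by
  have h0 : genDeriv s t 0 0 = 1 := by simp [genDeriv]
  refine ⟨fun ν x => genDeriv_sign hs ht x.2.1 ν, fun ν x => genDeriv_bound hs hγ ht htγ x.2.1 ν,
    fun x => ?_, fun x => ?_, fun ν x y => ?_⟩
  · rw [h0, mul_one, genDeriv_zero]
    have hx0 : (0 : ℝ) ≤ x := x.2.1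
    have hxa : (x : ℝ) ≤ a := x.2.2
    -- Here `γ ≥ 1` enters: `1 + t x ≤ 1 + a`, which gives the Harnack constant `(1 + a)^{-2s}`.
    have ht1 : t ≤ 1 := htγ.trans ((div_le_one (by linarith)).2 hγ)
    exact Real.rpow_le_rpow_of_nonpos (by positivity) (by nlinarith) (by linarith)
  · rw [h0]; exact genDeriv_zero_le_one hs ht x.2.1
  · rw [h0, mul_one]; exact abs_genDeriv_taylor_le hs hγ ht htγ x.2.1 y.2.1 ν

theorem JetBounds.zero : JetBounds ha s γ 0 := by
  constructor <;> simp

theorem JetBounds.add {F G : ℕ → Icc (0 : ℝ) a → ℝ} (hF : JetBounds ha s γ F)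
    (hG : JetBounds ha s γ G) : JetBounds ha s γ (F + G) := by
  refine ⟨fun ν x => ?_, fun ν x => ?_, fun x => ?_, fun x => ?_, fun ν x y => ?_⟩ <;>
    simp only [Pi.add_apply]
  · linarith [hF.sign ν x, hG.sign ν x]
  · linarith [hF.bound ν x, hG.bound ν x]
  · linarith [hF.lower x, hG.lower x]
  · linarith [hF.upper x, hG.upper x]
  · rw [mul_add (derivConst s γ (ν + 2) * _)]
    refine le_trans (le_of_eq ?_) ((abs_add_le _ _).trans
      (add_le_add (hF.taylor ν x y) (hG.taylor ν x y)))
    congr 1; ring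

theorem JetBounds.smul {F : ℕ → Icc (0 : ℝ) a → ℝ} (hF : JetBounds ha s γ F) {c : ℝ}
    (hc : 0 ≤ c) : JetBounds ha s γ (c • F) := by
  refine ⟨fun ν x => ?_, fun ν x => ?_, fun x => ?_, fun x => ?_, fun ν x y => ?_⟩ <;>
    simp only [Pi.smul_apply, smul_eq_mul]
  · nlinarith [mul_nonneg hc (hF.sign ν x)]
  · nlinarith [mul_le_mul_of_nonneg_left (hF.bound ν x) hc]
  · nlinarith [mul_le_mul_of_nonneg_left (hF.lower x) hc]
  · nlinarith [mul_le_mul_of_nonneg_left (hF.upper x) hc]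
  · have h := mul_le_mul_of_nonneg_left (hF.taylor ν x y) hc
    rw [← abs_of_nonneg hc, ← abs_mul, abs_of_nonneg hc] at h
    calc _ = |c * (F ν y - F ν x - ((y : ℝ) - x) * F (ν + 1) x)| := by congr 1; ring
      _ ≤ _ := h
      _ = _ := by ring

theorem JetBounds.nonneg {F : ℕ → Icc (0 : ℝ) a → ℝ} (hF : JetBounds ha s γ F)
    (x : Icc (0 : ℝ) a) : 0 ≤ F 0 x := by
  simpa using hF.sign 0 x

theorem JetBounds.abs_le {F : ℕ → Icc (0 : ℝ) a → ℝ} (hF : JetBounds ha s γ F) (hs : 0 < s)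
    (hγ : 1 ≤ γ) (ν : ℕ) (x : Icc (0 : ℝ) a) :
    |F ν x| ≤ derivConst s γ ν * F 0 ⟨0, le_rfl, ha.le⟩ := by
  have h3 : |F ν x| = |(-1) ^ ν * F ν x| := by simp [abs_mul]
  rw [h3, abs_of_nonneg (hF.sign ν x)]
  exact (hF.bound ν x).trans
    (mul_le_mul_of_nonneg_left (hF.upper x) (derivConst_nonneg hs hγ ν))

/-- Every condition is a non-strict inequality between continuous functions of finitely many values
of `F`, hence closed in the product topology. -/
theorem isClosed_jetBounds (ha : 0 < a) (s γ : ℝ) : IsClosed {F | JetBounds ha s γ F} := by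
  have h : {F | JetBounds ha s γ F} =
      (⋂ ν, ⋂ x, {F : ℕ → Icc (0 : ℝ) a → ℝ | 0 ≤ (-1) ^ ν * F ν x}) ∩
      (⋂ ν, ⋂ x, {F | (-1) ^ ν * F ν x ≤ derivConst s γ ν * F 0 x}) ∩
      (⋂ x, {F | (1 + a) ^ (-(2 * s)) * F 0 ⟨0, le_rfl, ha.le⟩ ≤ F 0 x}) ∩
      (⋂ x, {F | F 0 x ≤ F 0 ⟨0, le_rfl, ha.le⟩}) ∩
      (⋂ ν, ⋂ x : Icc (0 : ℝ) a, ⋂ y : Icc (0 : ℝ) a,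
        {F | |F ν y - F ν x - ((y : ℝ) - x) * F (ν + 1) x|
          ≤ derivConst s γ (ν + 2) * ((y : ℝ) - x) ^ 2 * F 0 ⟨0, le_rfl, ha.le⟩}) := by
    ext F
    simp only [mem_inter_iff, mem_iInter, mem_ofPred_eq]
    exact ⟨fun h => ⟨⟨⟨⟨h.1, h.2⟩, h.3⟩, h.4⟩, h.5⟩, fun h => ⟨h.1.1.1.1, h.1.1.1.2, h.1.1.2, h.1.2, h.2⟩⟩
  have e : ∀ ν (x : Icc (0 : ℝ) a), Continuous fun F : ℕ → Icc (0 : ℝ) a → ℝ => F ν x :=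
    fun ν x => (continuous_apply x).comp (continuous_apply ν)
  rw [h]
  refine (((IsClosed.inter ?_ ?_).inter ?_).inter ?_).inter ?_
  · exact isClosed_iInter fun ν => isClosed_iInter fun x =>
      isClosed_le continuous_const (continuous_const.mul (e ν x))
  · exact isClosed_iInter fun ν => isClosed_iInter fun x =>
      isClosed_le (continuous_const.mul (e ν x)) (continuous_const.mul (e 0 x))
  · exact isClosed_iInter fun x => isClosed_le (continuous_const.mul (e 0 _)) (e 0 x)
  · exact isClosed_iInter fun x => isClosed_le (e 0 x) (e 0 _)
  · exact isClosed_iInter fun ν => isClosed_iInter fun x => isClosed_iInter fun y =>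
      isClosed_le (((e ν y).sub (e ν x)).sub (continuous_const.mul (e (ν + 1) x))).abs
        (continuous_const.mul (e 0 _))

/-- Tychonoff: the value at `0` controls all entries. The lower bound `1` keeps limits away from
zero. -/
theorem isCompact_jetBounds (ha : 0 < a) (hs : 0 < s) (hγ : 1 ≤ γ) (C : ℝ) :
    IsCompact {F | JetBounds ha s γ F ∧ F 0 ⟨0, le_rfl, ha.le⟩ ∈ Icc 1 C} := by
  have hK : IsCompact (Set.pi univ fun ν : ℕ => Set.pi univ fun _ : Icc (0 : ℝ) a =>
      Icc (-(derivConst s γ ν * C)) (derivConst s γ ν * C)) :=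
    isCompact_univ_pi fun ν => isCompact_univ_pi fun _ => isCompact_Icc
  refine hK.of_isClosed_subset ?_ ?_
  · exact (isClosed_jetBounds ha s γ).inter
      ((isClosed_Icc (a := (1 : ℝ)) (b := C)).preimage
        ((continuous_apply (⟨0, le_rfl, ha.le⟩ : Icc (0 : ℝ) a)).comp
          (continuous_apply (A := fun _ : ℕ => Icc (0 : ℝ) a → ℝ) 0)))
  · rintro F ⟨hF, -, h2⟩ ν - x -
    exact abs_le.1 ((hF.abs_le hs hγ ν x).trans
      (mul_le_mul_of_nonneg_left h2 (derivConst_nonneg hs hγ ν)))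

/-- The Taylor remainder is quadratic in `y - x`, so a limit of tuples of derivatives is again one.
-/
theorem JetBounds.hasDerivWithinAt {F : ℕ → Icc (0 : ℝ) a → ℝ} (hF : JetBounds ha s γ F)
    (ν : ℕ) (x : Icc (0 : ℝ) a) :
    HasDerivWithinAt (zeroExt (F ν)) (F (ν + 1) x) (Icc 0 a) x := by
  rw [hasDerivWithinAt_iff_isLittleO]
  refine Asymptotics.IsBigO.trans_isLittleO (g := fun y : ℝ => ‖y - x‖ ^ 2) ?_
    ((Asymptotics.isLittleO_pow_sub_sub (x : ℝ) one_lt_two).mono nhdsWithin_le_nhds)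
  refine Asymptotics.IsBigO.of_bound
    (derivConst s γ (ν + 2) * F 0 ⟨0, le_rfl, ha.le⟩) ?_
  filter_upwards [self_mem_nhdsWithin] with y hy
  have h := hF.taylor ν x ⟨y, hy⟩
  have hy' := zeroExt_coe (F ν) ⟨y, hy⟩
  simp only at h hy'
  rw [zeroExt_coe, hy']
  simp only [smul_eq_mul, Real.norm_eq_abs, sq_abs, norm_pow]
  linarith

theorem JetBounds.iteratedDerivWithin_eqOn {F : ℕ → Icc (0 : ℝ) a → ℝ}
    (hF : JetBounds ha s γ F) (ν : ℕ) :
    EqOn (iteratedDerivWithin ν (zeroExt (F 0)) (Icc 0 a)) (zeroExt (F ν)) (Icc 0 a) := by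
  induction ν with
  | zero => intro x _; rw [iteratedDerivWithin_zero]
  | succ ν ih =>
    intro x hx
    rw [iteratedDerivWithin_succ, derivWithin_congr ih (ih hx),
      (hF.hasDerivWithinAt ν ⟨x, hx⟩).derivWithin (uniqueDiffOn_Icc ha x hx)]
    exact (zeroExt_coe (F (ν + 1)) ⟨x, hx⟩).symm

theorem JetBounds.contDiffOn {F : ℕ → Icc (0 : ℝ) a → ℝ} (hF : JetBounds ha s γ F) :
    ContDiffOn ℝ ∞ (zeroExt (F 0)) (Icc 0 a) := by
  refine contDiffOn_of_differentiableOn_deriv fun ν _ x hx => ?_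
  exact ((hF.hasDerivWithinAt ν ⟨x, hx⟩).congr (hF.iteratedDerivWithin_eqOn ν)
    (hF.iteratedDerivWithin_eqOn ν hx)).differentiableWithinAt

/-! ### The invariant cone -/

/-- The cone spanned by the derivative tuples of `x ↦ (1 + t x)^{-2s}`, `0 ≤ t ≤ 1 / γ`. -/
def jetCone (a s γ : ℝ) : Submodule ℝ≥0 (ℕ → Icc (0 : ℝ) a → ℝ) :=
  Submodule.span ℝ≥0 ((fun t ν x => genDeriv s t ν x) '' Icc 0 (1 / γ))

theorem jetBounds_of_mem_jetCone (hs : 0 < s) (hγ : 1 ≤ γ) {F : ℕ → Icc (0 : ℝ) a → ℝ}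
    (hF : F ∈ jetCone a s γ) : JetBounds ha s γ F := by
  induction hF using Submodule.span_induction with
  | mem F h =>
    obtain ⟨t, ht, rfl⟩ := h
    exact .gen hs hγ ht.1 ht.2
  | zero => exact .zero
  | add F G _ _ hF hG => exact hF.add hG
  | smul c F _ hF => exact hF.smul c.2

variable {B : Finset ℝ} (hB : Admissible a B)

theorem transferFun_add (s : ℝ) (f g : Icc (0 : ℝ) a → ℝ) :
    transferFun hB s (f + g) = transferFun hB s f + transferFun hB s g := by
  funext x
  simp only [transferFun, Pi.add_apply, mul_add, Finset.sum_add_distrib]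

theorem transferFun_smul (s c : ℝ) (f : Icc (0 : ℝ) a → ℝ) :
    transferFun hB s (c • f) = c • transferFun hB s f := by
  funext x
  simp only [transferFun, Pi.smul_apply, smul_eq_mul, Finset.mul_sum]
  exact Finset.sum_congr rfl fun β _ => by ring

theorem weight_pos {a : ℝ} {B : Finset ℝ} (hB : Admissible a B) (s : ℝ) (x : Icc (0 : ℝ) a) (β : B) :
    0 < ((x : ℝ) + β) ^ (-(2 * s)) := by
  have h1 := (hB β β.2).1
  have h2 : (0 : ℝ) ≤ x := x.2.1
  positivity

theorem transferFun_mono (s : ℝ) : Monotone (transferFun hB s) := fun _ _ h x =>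
  Finset.sum_le_sum fun β _ => mul_le_mul_of_nonneg_left (h _) (weight_pos hB s x β).le

theorem transferFun_pos (hBne : B.Nonempty) (s : ℝ) {f : Icc (0 : ℝ) a → ℝ} (hf : ∀ x, 0 < f x)
    (x : Icc (0 : ℝ) a) : 0 < transferFun hB s f x :=
  Finset.sum_pos (fun β _ => mul_pos (weight_pos hB s x β) (hf _)) hBne.attach

theorem continuous_transferFun (s : ℝ) : Continuous (transferFun hB s) :=
  continuous_pi fun _ => continuous_finsetSum _ fun _ _ =>
    continuous_const.mul (continuous_apply _)

/-- On a generator, `(x + β)^{-2s} (1 + t / (x + β))^{-2s} = (β + t)^{-2s} (1 + x / (β + t))^{-2s}`,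
and `β + t ≥ γ`. The rest is linearity. -/
theorem exists_jetCone_transferFun (hγ : 1 ≤ γ) (hBγ : ∀ β ∈ B, γ ≤ β)
    {F : ℕ → Icc (0 : ℝ) a → ℝ} (hF : F ∈ jetCone a s γ) :
    ∃ G ∈ jetCone a s γ, G 0 = transferFun hB s (F 0) := by
  induction hF using Submodule.span_induction with
  | mem F h =>
    obtain ⟨t, ht, rfl⟩ := h
    refine ⟨∑ β ∈ B, ((β + t) ^ (-(2 * s))).toNNReal •
      fun ν (x : Icc (0 : ℝ) a) => genDeriv s (1 / (β + t)) ν x,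
      Submodule.sum_mem _ fun β hβ => Submodule.smul_mem _ _ (Submodule.subset_span
        ⟨1 / (β + t), ⟨?_, ?_⟩, rfl⟩), ?_⟩
    · have := hBγ β hβ; have := ht.1; exact one_div_nonneg.2 (by linarith)
    · have := hBγ β hβ; have := ht.1
      exact one_div_le_one_div_of_le (by linarith) (by linarith)
    · funext x
      rw [Finset.sum_apply, Finset.sum_apply, transferFun, ← Finset.sum_attach B]
      refine Finset.sum_congr rfl fun β _ => ?_
      have h1 := hBγ β β.2
      have h2 := ht.1
      have h3 : (0 : ℝ) ≤ x := x.2.1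
      have h4 : 0 < (β : ℝ) + t := by linarith
      have h5 : 0 < (x : ℝ) + β := by linarith
      simp only [Pi.smul_apply, NNReal.smul_def, smul_eq_mul, genDeriv_zero]
      rw [Real.coe_toNNReal _ (by positivity), ← Real.mul_rpow h4.le (by positivity),
        ← Real.mul_rpow h5.le (by positivity)]
      congr 1
      field_simp
      ring
  | zero => exact ⟨0, zero_mem _, by simpa using (transferFun_smul hB s 0 0).symm⟩
  | add F G _ _ hF hG =>
    obtain ⟨F', h1, h2⟩ := hF
    obtain ⟨G', h3, h4⟩ := hG
    exact ⟨F' + G', add_mem h1 h3, by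
      rw [Pi.add_apply, Pi.add_apply, transferFun_add, h2, h4]⟩
  | smul c F _ hF =>
    obtain ⟨F', h1, h2⟩ := hF
    exact ⟨c • F', Submodule.smul_mem _ _ h1, by
      rw [Pi.smul_apply, Pi.smul_apply, h2]
      exact (transferFun_smul hB s c _).symm⟩

theorem exists_jetCone_iterate (hγ : 1 ≤ γ) (hBγ : ∀ β ∈ B, γ ≤ β) (n : ℕ) :
    ∃ G ∈ jetCone a s γ, G 0 = (transferFun hB s)^[n] 1 := by
  induction n with
  | zero =>
    -- The constant `1` is the generator with `t = 0`.
    refine ⟨_, Submodule.subset_span ⟨0, ⟨le_rfl, by positivity⟩, rfl⟩, ?_⟩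
    funext x
    simp [genDeriv]
  | succ n ih =>
    obtain ⟨G, h1, h2⟩ := ih
    rw [Function.iterate_succ_apply', ← h2]
    exact exists_jetCone_transferFun hB hγ hBγ h1

/-! ### Growth rate of the iterates -/

/-- An almost multiplicative sequence has geometric growth, up to a constant factor. -/
theorem exists_geometric_rate {b : ℕ → ℝ} {c : ℝ} (hc : 0 < c) (hc1 : c ≤ 1) (hb : ∀ n, 0 < b n)
    (hb0 : b 0 = 1) (hsub : ∀ n m, b (n + m) ≤ b n * b m)
    (hsup : ∀ n m, c * (b n * b m) ≤ b (n + m)) :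
    ∃ r : ℝ, 0 < r ∧ ∀ n, r ^ n ≤ b n ∧ c * b n ≤ r ^ n := by
  -- The sequence `c * b n` is supermultiplicative, while `b` itself is submultiplicative.
  have h1 : ∀ n k, (c * b n) ^ (k + 1) ≤ c * b (n * (k + 1)) := by
    intro n k
    induction k with
    | zero => simp
    | succ k ih =>
      calc (c * b n) ^ (k + 1 + 1) = (c * b n) ^ (k + 1) * (c * b n) := pow_succ _ _
        _ ≤ c * b (n * (k + 1)) * (c * b n) := by have := hb n; gcongr
        _ = c * (c * (b (n * (k + 1)) * b n)) := by ring
        _ ≤ c * b (n * (k + 1) + n) := by gcongr; exact hsup _ _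
        _ = _ := by congr 2
  have h2 : ∀ n k, b (n * k) ≤ b n ^ k := by
    intro n k
    induction k with
    | zero => simp [hb0]
    | succ k ih =>
      rw [mul_add, mul_one, pow_succ]
      exact (hsub _ _).trans (mul_le_mul_of_nonneg_right ih (hb n).le)
  have hcb : ∀ n, 0 < c * b n := fun n => mul_pos hc (hb n)
  -- As in Fekete's lemma, every root `(c * b n)^{1/n}` lies below every `b m ^ (1/m)`; the supremum
  -- of the former serves as `r`. The shift by one avoids zeroth roots.
  set ρ : ℕ → ℝ := fun n => (c * b (n + 1)) ^ (((n + 1 : ℕ) : ℝ)⁻¹) with hρ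
  have hle : ∀ n m, ρ n ≤ b (m + 1) ^ (((m + 1 : ℕ) : ℝ)⁻¹) := by
    intro n m
    have h3 : (c * b (n + 1)) ^ (m + 1) ≤ b (m + 1) ^ (n + 1) :=
      (h1 (n + 1) m).trans (((mul_le_of_le_one_left (hb _).le hc1).trans
        (le_of_eq (by rw [mul_comm]))).trans (h2 (m + 1) (n + 1)))
    refine le_of_pow_le_pow_left₀ (n := (n + 1) * (m + 1)) (by positivity)
      (Real.rpow_nonneg (hb _).le _) ?_
    rw [pow_mul, hρ, Real.rpow_inv_natCast_pow (hcb _).le (by omega), mul_comm (n + 1), pow_mul,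
      Real.rpow_inv_natCast_pow (hb _).le (by omega)]
    exact h3
  have hbdd : BddAbove (range ρ) := ⟨_, by rintro _ ⟨n, rfl⟩; exact hle n 0⟩
  refine ⟨⨆ n, ρ n, (Real.rpow_pos_of_pos (hcb 1) _).trans_le (le_ciSup hbdd 0), fun n => ?_⟩
  obtain _ | n := n
  · simpa [hb0] using hc1
  have hρ0 : 0 ≤ ρ n := Real.rpow_nonneg (hcb _).le _
  constructor
  · calc (⨆ n, ρ n) ^ (n + 1) ≤ (b (n + 1) ^ (((n + 1 : ℕ) : ℝ)⁻¹)) ^ (n + 1) :=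
        pow_le_pow_left₀ (hρ0.trans (le_ciSup hbdd n)) (ciSup_le fun k => hle k n) _
      _ = _ := Real.rpow_inv_natCast_pow (hb _).le (by omega)
  · calc c * b (n + 1) = ρ n ^ (n + 1) :=
        (Real.rpow_inv_natCast_pow (hcb _).le (by omega)).symm
      _ ≤ _ := pow_le_pow_left₀ hρ0 (le_ciSup hbdd n) _

theorem JetBounds.sum {ι : Type*} (S : Finset ι) {F : ι → ℕ → Icc (0 : ℝ) a → ℝ}
    (hF : ∀ i ∈ S, JetBounds ha s γ (F i)) : JetBounds ha s γ (∑ i ∈ S, F i) :=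
  Finset.sum_induction F (JetBounds ha s γ) (fun _ _ => .add) .zero hF

/-- The formula for `Λ_s` as a linear map on all functions on `[0, a]`. -/
noncomputable def transferLM {B : Finset ℝ} (hB : Admissible a B) (s : ℝ) :
    (Icc (0 : ℝ) a → ℝ) →ₗ[ℝ] (Icc (0 : ℝ) a → ℝ) where
  toFun := transferFun hB s
  map_add' := transferFun_add hB s
  map_smul' := transferFun_smul hB s

theorem iterate_transferFun_smul (s c : ℝ) (n : ℕ) (f : Icc (0 : ℝ) a → ℝ) :
    (transferFun hB s)^[n] (c • f) = c • (transferFun hB s)^[n] f :=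
  Function.Commute.iterate_left (f := transferFun hB s) (g := (c • ·))
    (fun f => transferFun_smul hB s c f) n f

/-- By the Harnack inequality `Λ_s^m 1` lies between `c * b m` and `b m`; applying the monotone
operator `Λ_s^n` and evaluating at `0` compares `b (n + m)` with `b n * b m`. -/
theorem exists_rate (ha : 0 < a) (hBne : B.Nonempty) (hs : 0 < s) (hγ : 1 ≤ γ)
    (hBγ : ∀ β ∈ B, γ ≤ β) :
    ∃ r : ℝ, 0 < r ∧ ∀ n x, (transferFun hB s)^[n] 1 x ≤ (1 + a) ^ (2 * s) * r ^ n ∧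
      r ^ n ≤ (transferFun hB s)^[n] 1 ⟨0, le_rfl, ha.le⟩ := by
  set c : ℝ := (1 + a) ^ (-(2 * s)) with hc
  have hc0 : 0 < c := by positivity
  have hc1 : c ≤ 1 := Real.rpow_le_one_of_one_le_of_nonpos (by linarith) (by linarith)
  set o : Icc (0 : ℝ) a := ⟨0, le_rfl, ha.le⟩
  have hJ : ∀ n, ∀ x, c * (transferFun hB s)^[n] 1 o ≤ (transferFun hB s)^[n] 1 x ∧
      (transferFun hB s)^[n] 1 x ≤ (transferFun hB s)^[n] 1 o := fun n x => by
    obtain ⟨G, hG, h0⟩ := exists_jetCone_iterate (s := s) hB hγ hBγ n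
    have := jetBounds_of_mem_jetCone (ha := ha) hs hγ hG
    rw [← h0]
    exact ⟨this.lower x, this.upper x⟩
  have hpos : ∀ n x, 0 < (transferFun hB s)^[n] 1 x := by
    intro n
    induction n with
    | zero => intro x; simp
    | succ n ih => rw [Function.iterate_succ_apply']; exact transferFun_pos hB hBne s ih
  have hmono : ∀ n, Monotone (transferFun hB s)^[n] := (transferFun_mono hB s).iterate
  obtain ⟨r, hr, h⟩ := exists_geometric_rate (b := fun n => (transferFun hB s)^[n] 1 o) hc0 hc1
    (fun n => hpos n o) rfl (fun n m => by
      have h1 : (transferFun hB s)^[m] 1 ≤ ((transferFun hB s)^[m] 1 o) • 1 := fun x => by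
        simpa using (hJ m x).2
      have h2 := hmono n h1 o
      rw [iterate_transferFun_smul, ← Function.iterate_add_apply] at h2
      simpa [mul_comm] using h2) (fun n m => by
      have h1 : (c * (transferFun hB s)^[m] 1 o) • 1 ≤ (transferFun hB s)^[m] 1 := fun x => by
        simpa using (hJ m x).1
      have h2 := hmono n h1 o
      rw [iterate_transferFun_smul, ← Function.iterate_add_apply] at h2
      simp only [Pi.smul_apply, smul_eq_mul] at h2
      linarith)
  refine ⟨r, hr, fun n x => ⟨(hJ n x).2.trans ?_, (h n).1⟩⟩
  have h3 := (h n).2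
  have h4 : (1 + a) ^ (2 * s) * c = 1 := by
    rw [hc, ← Real.rpow_add (by linarith)]; simp
  calc _ = (1 + a) ^ (2 * s) * (c * (transferFun hB s)^[n] 1 o) := by
        rw [← mul_assoc, h4, one_mul]
    _ ≤ _ := by gcongr

/-! ### Existence by averaging and compactness -/

theorem exists_eigenJet (ha : 0 < a) (hBne : B.Nonempty) (hs : 0 < s) (hγ : 1 ≤ γ)
    (hBγ : ∀ β ∈ B, γ ≤ β) :
    ∃ (r : ℝ) (V : ℕ → Icc (0 : ℝ) a → ℝ), JetBounds ha s γ V ∧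
      1 ≤ V 0 ⟨0, le_rfl, ha.le⟩ ∧ transferFun hB s (V 0) = r • V 0 := by
  obtain ⟨r, hr, hrate⟩ := exists_rate hB ha hBne hs hγ hBγ
  set K : ℝ := (1 + a) ^ (2 * s) with hK
  have hK0 : 0 < K := by positivity
  choose J hJ hJ0 using exists_jetCone_iterate (s := s) hB hγ hBγ
  set h : ℕ → Icc (0 : ℝ) a → ℝ := fun n => (r ^ n)⁻¹ • (transferFun hB s)^[n] 1 with hh
  have hTh : ∀ n, transferLM hB s (h n) = r • h (n + 1) := fun n => by
    simp only [hh]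
    rw [map_smul, Function.iterate_succ_apply', smul_smul, pow_succ, mul_inv, mul_comm r,
      mul_assoc, inv_mul_cancel₀ hr.ne', mul_one]
    rfl
  have hh1 : ∀ n, 1 ≤ h n ⟨0, le_rfl, ha.le⟩ := fun n => by
    simp only [hh, Pi.smul_apply, smul_eq_mul]
    rw [inv_mul_eq_div, one_le_div (by positivity)]
    exact (hrate n ⟨0, le_rfl, ha.le⟩).2
  have hhK : ∀ n x, h n x ≤ K := fun n x => by
    simp only [hh, Pi.smul_apply, smul_eq_mul]
    rw [inv_mul_eq_div, div_le_iff₀ (by positivity)]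
    exact (hrate n x).1
  have hh0 : ∀ n x, 0 ≤ h n x := fun n x => by
    simp only [hh, Pi.smul_apply, smul_eq_mul, ← hJ0]
    exact mul_nonneg (by positivity) ((jetBounds_of_mem_jetCone (ha := ha) hs hγ (hJ n)).nonneg x)
  -- Cesàro averages, formed for whole tuples of derivatives: convergence of `h n` itself is not
  -- needed.
  set G : ℕ → ℕ → Icc (0 : ℝ) a → ℝ := fun N =>
    ((N : ℝ) + 1)⁻¹ • ∑ n ∈ Finset.range (N + 1), (r ^ n)⁻¹ • J n with hG
  have hG0 : ∀ N, G N 0 = ((N : ℝ) + 1)⁻¹ • ∑ n ∈ Finset.range (N + 1), h n := fun N => by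
    simp only [hG, hh, Pi.smul_apply, Finset.sum_apply, hJ0]
  have hGJ : ∀ N, JetBounds ha s γ (G N) := fun N =>
    (JetBounds.sum _ fun n _ => (jetBounds_of_mem_jetCone hs hγ (hJ n)).smul
      (by positivity)).smul (by positivity)
  have hGmem : ∀ N, G N ∈ {F | JetBounds ha s γ F ∧ F 0 ⟨0, le_rfl, ha.le⟩ ∈ Icc 1 K} := by
    intro N
    refine ⟨hGJ N, ?_⟩
    rw [hG0, Pi.smul_apply, Finset.sum_apply, smul_eq_mul, inv_mul_eq_div]
    constructor
    · rw [one_le_div (by positivity)]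
      simpa using Finset.card_nsmul_le_sum (Finset.range (N + 1)) _ 1 fun n _ => hh1 n
    · rw [div_le_iff₀ (by positivity), mul_comm]
      simpa using Finset.sum_le_card_nsmul (Finset.range (N + 1)) _ K
        fun n _ => hhK n ⟨0, le_rfl, ha.le⟩
  -- Telescoping: the defect of the eigenvalue equation is only a boundary term over `N + 1`.
  have hTG : ∀ N, transferFun hB s (G N 0) - r • G N 0 =
      (r * ((N : ℝ) + 1)⁻¹) • (h (N + 1) - h 0) := fun N => by
    change transferLM hB s (G N 0) - r • G N 0 = _
    rw [hG0, map_smul, map_sum, ← Finset.sum_range_sub, smul_comm r, ← smul_sub, Finset.smul_sum,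
      ← Finset.sum_sub_distrib, mul_comm r, mul_smul, Finset.smul_sum]
    simp only [hTh, ← smul_sub, Finset.smul_sum]
  -- The product is over an uncountable index set, so a limit along a free ultrafilter replaces a
  -- convergent subsequence.
  obtain ⟨V, hV, hVlim⟩ := (isCompact_jetBounds ha hs hγ K).ultrafilter_le_nhds'
    ((hyperfilter ℕ).map G) (Ultrafilter.mem_map.2 (Filter.univ_mem' hGmem))
  have hlim : Tendsto G (hyperfilter ℕ : Filter ℕ) (𝓝 V) := hVlim
  refine ⟨r, V, hV.1, hV.2.1, sub_eq_zero.1 ?_⟩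
  have hcont : Continuous fun F : ℕ → Icc (0 : ℝ) a → ℝ => transferFun hB s (F 0) - r • F 0 :=
    ((continuous_transferFun hB s).comp (continuous_apply 0)).sub
      ((continuous_apply 0).const_smul r)
  refine tendsto_nhds_unique ((hcont.tendsto V).comp hlim) ?_
  refine Tendsto.mono_left ?_ (Nat.hyperfilter_le_atTop)
  rw [tendsto_pi_nhds]
  intro x
  simp only [Function.comp_apply, hTG]
  have h0 : Tendsto (fun N : ℕ => r * ((N : ℝ) + 1)⁻¹ * K) atTop (𝓝 0) := by
    simpa using ((tendsto_inv_atTop_zero.comp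
      (tendsto_atTop_add_const_right atTop (1 : ℝ) tendsto_natCast_atTop_atTop)).const_mul
        r).mul_const K
  refine squeeze_zero_norm (fun N => ?_) h0
  rw [Pi.smul_apply, norm_smul, Real.norm_of_nonneg (by positivity)]
  refine mul_le_mul_of_nonneg_left ?_ (by positivity)
  rw [Pi.sub_apply, Real.norm_eq_abs, abs_le]
  constructor <;> linarith [hh0 (N + 1) x, hh0 0 x, hhK (N + 1) x, hhK 0 x]

/-! ### Uniqueness -/

/-- The inverse branch `x ↦ 1 / (x + β)` as a self-map of `[0, a]`. -/
noncomputable def branch (β : B) (x : Icc (0 : ℝ) a) : Icc (0 : ℝ) a :=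
  ⟨1 / ((x : ℝ) + β), hB.branch_mem β.2 x.2⟩

/-- One step need not contract: for `β = 1` the branch has derivative `-1` at `0`. The second
iterate is a Möbius map of determinant `1` with denominator at least `2`. -/
theorem dist_branch_branch_le {β : B} (hβ : 1 ≤ (β : ℝ)) (x y : Icc (0 : ℝ) a) :
    dist (branch hB β (branch hB β x)) (branch hB β (branch hB β y)) ≤ 1 / 4 * dist x y := by
  have hx : (0 : ℝ) ≤ x := x.2.1
  have hy : (0 : ℝ) ≤ y := y.2.1
  simp only [Subtype.dist_eq, branch, Real.dist_eq]
  set b : ℝ := β.1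
  set p : ℝ := 1 + b * (x + b) with hp
  set q : ℝ := 1 + b * (y + b) with hq
  have hp2 : 2 ≤ p := by nlinarith
  have hq2 : 2 ≤ q := by nlinarith
  have hxb : 0 < (x : ℝ) + b := by linarith
  have hyb : 0 < (y : ℝ) + b := by linarith
  have e : 1 / (1 / ((x : ℝ) + b) + b) - 1 / (1 / ((y : ℝ) + b) + b) = (x - y) / (p * q) := by
    have e1 : 1 / (1 / ((x : ℝ) + b) + b) = (x + b) / p := by
      rw [hp]; field_simp
    have e2 : 1 / (1 / ((y : ℝ) + b) + b) = (y + b) / q := by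
      rw [hq]; field_simp
    rw [e1, e2, div_sub_div _ _ (by positivity) (by positivity)]
    congr 1
    rw [hp, hq]; ring
  rw [e, abs_div, abs_of_pos (show 0 < p * q by positivity), div_eq_mul_one_div, mul_comm]
  refine mul_le_mul_of_nonneg_right ?_ (abs_nonneg _)
  exact one_div_le_one_div_of_le (by norm_num) (by nlinarith)

theorem exists_dist_iterate_branch_lt {β : B} (hβ : 1 ≤ (β : ℝ)) (x y : Icc (0 : ℝ) a) {δ : ℝ}
    (hδ : 0 < δ) : ∃ n, dist ((branch hB β)^[n] x) ((branch hB β)^[n] y) < δ := by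
  have h : ∀ n, dist ((branch hB β)^[2 * n] x) ((branch hB β)^[2 * n] y)
      ≤ (1 / 4) ^ n * dist x y := by
    intro n
    induction n with
    | zero => simp
    | succ n ih =>
      rw [mul_add, mul_one, Function.iterate_succ_apply', Function.iterate_succ_apply',
        Function.iterate_succ_apply', Function.iterate_succ_apply']
      refine (dist_branch_branch_le hB hβ _ _).trans ?_
      rw [pow_succ]
      linarith
  have h0 : Tendsto (fun n : ℕ => (1 / 4 : ℝ) ^ n * dist x y) atTop (𝓝 0) := by
    simpa using (tendsto_pow_atTop_nhds_zero_of_lt_one (r := (1 / 4 : ℝ)) (by norm_num)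
      (by norm_num)).mul_const (dist x y)
  obtain ⟨n, hn⟩ := (h0.eventually (gt_mem_nhds hδ)).exists
  exact ⟨2 * n, (h n).trans_lt hn⟩

/-- At a zero of `f`, a sum of nonnegative terms with positive weights vanishes, so `f` vanishes at
all images of that point. -/
theorem eq_zero_iterate_branch {r : ℝ} {f : Icc (0 : ℝ) a → ℝ} (hf : ∀ x, 0 ≤ f x)
    (hTf : transferFun hB s f = r • f) (β : B) {x : Icc (0 : ℝ) a} (hx : f x = 0) (n : ℕ) :
    f ((branch hB β)^[n] x) = 0 := by
  induction n with
  | zero => exact hx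
  | succ n ih =>
    rw [Function.iterate_succ_apply']
    set y := (branch hB β)^[n] x
    have h1 : transferFun hB s f y = 0 := by rw [hTf, Pi.smul_apply, ih, smul_zero]
    have h2 := (Finset.sum_eq_zero_iff_of_nonneg fun β' _ =>
      mul_nonneg (weight_pos hB s y β').le (hf _)).1 h1 β (Finset.mem_attach _ _)
    exact (mul_eq_zero.1 h2).resolve_left (weight_pos hB s y β).ne'

theorem eq_smul_of_positive_eigenfunctions (ha : 0 < a) (hBne : B.Nonempty)
    (hB1 : ∀ β ∈ B, (1 : ℝ) ≤ β) {u v : Icc (0 : ℝ) a → ℝ} (huc : Continuous u)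
    (hvc : Continuous v) (hu : ∀ x, 0 < u x) (hv : ∀ x, 0 < v x) {ρ r : ℝ}
    (hTu : transferFun hB s u = ρ • u) (hTv : transferFun hB s v = r • v) :
    ∃ c : ℝ, 0 < c ∧ u = c • v := by
  have : Nonempty (Icc (0 : ℝ) a) := ⟨⟨0, le_rfl, ha.le⟩⟩
  set g : Icc (0 : ℝ) a → ℝ := fun x => u x / v x with hg
  have hgc : Continuous g := huc.div hvc fun x => (hv x).ne'
  have hgv : ∀ x, u x = g x * v x := fun x => (div_mul_cancel₀ _ (hv x).ne').symm
  obtain ⟨x₀, -, hx₀⟩ := isCompact_univ.exists_isMinOn univ_nonempty hgc.continuousOn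
  obtain ⟨x₁, -, hx₁⟩ := isCompact_univ.exists_isMaxOn univ_nonempty hgc.continuousOn
  have hmin : ∀ x, g x₀ * v x ≤ u x := fun x => by
    rw [hgv x]; exact mul_le_mul_of_nonneg_right (hx₀ (mem_univ x)) (hv x).le
  have hmax : ∀ x, u x ≤ g x₁ * v x := fun x => by
    rw [hgv x]; exact mul_le_mul_of_nonneg_right (hx₁ (mem_univ x)) (hv x).le
  -- Applying `Λ_s` to `u ≤ g x₁ • v` and evaluating where equality holds gives `ρ ≤ r`; the minimum
  -- gives the converse.
  have hρ : ρ = r := by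
    refine le_antisymm ?_ ?_
    · have h : transferFun hB s u x₁ ≤ transferFun hB s (g x₁ • v) x₁ :=
        transferFun_mono hB s hmax x₁
      rw [transferFun_smul, hTu, hTv] at h
      simp only [Pi.smul_apply, smul_eq_mul] at h
      rw [mul_left_comm, ← hgv] at h
      exact le_of_mul_le_mul_right h (hu x₁)
    · have h : transferFun hB s (g x₀ • v) x₀ ≤ transferFun hB s u x₀ :=
        transferFun_mono hB s hmin x₀
      rw [transferFun_smul, hTu, hTv] at h
      simp only [Pi.smul_apply, smul_eq_mul] at h
      rw [mul_left_comm, ← hgv] at h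
      exact le_of_mul_le_mul_right h (hu x₀)
  subst hρ
  have hlin : ∀ p q : ℝ, transferFun hB s (p • u + q • v) = ρ • (p • u + q • v) := fun p q => by
    rw [transferFun_add, transferFun_smul, transferFun_smul, hTu, hTv, smul_add, smul_comm p,
      smul_comm q]
  obtain ⟨β, hβ⟩ := hBne
  -- The eigenfunction `u - g x₀ • v` is nonnegative and vanishes at `x₀`, hence along the orbit of
  -- `x₀`.
  have h0 : ∀ n, g ((branch hB ⟨β, hβ⟩)^[n] x₀) = g x₀ := fun n => by
    have h := eq_zero_iterate_branch hB (f := (1 : ℝ) • u + (-g x₀) • v)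
      (fun x => by simpa using hmin x) (hlin _ _) ⟨β, hβ⟩ (x := x₀)
      (by simp [hgv x₀]) n
    simp only [Pi.add_apply, Pi.smul_apply, smul_eq_mul] at h
    rw [hg, div_eq_iff (hv _).ne']
    linarith
  have h1 : ∀ n, g ((branch hB ⟨β, hβ⟩)^[n] x₁) = g x₁ := fun n => by
    have h := eq_zero_iterate_branch hB (f := (-1 : ℝ) • u + g x₁ • v)
      (fun x => by simpa using hmax x) (hlin _ _) ⟨β, hβ⟩ (x := x₁)
      (by simp [hgv x₁]) n
    simp only [Pi.add_apply, Pi.smul_apply, smul_eq_mul] at h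
    rw [hg, div_eq_iff (hv _).ne']
    linarith
  -- The two orbits come arbitrarily close, whereas `g` stays at its minimum on one and at its
  -- maximum on the other; uniform continuity forces equality.
  have heq : g x₀ = g x₁ := by
    by_contra hne
    obtain ⟨δ, hδ, hu⟩ := Metric.uniformContinuous_iff.1
      (CompactSpace.uniformContinuous_of_continuous hgc) _ (dist_pos.2 hne)
    obtain ⟨n, hn⟩ := exists_dist_iterate_branch_lt hB (β := ⟨β, hβ⟩) (hB1 β hβ) x₀ x₁ hδ
    have := hu hn
    rw [h0, h1] at this
    exact lt_irrefl _ this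
  exact ⟨g x₀, div_pos (hu _) (hv _), funext fun x =>
    le_antisymm (by rw [heq]; exact hmax x) (hmin x)⟩

theorem CmSpace.continuous_coe {m : ℕ} (f : CmSpace a ha m) : Continuous f.1 := by
  have hf : ContDiffOn ℝ m (zeroExt f.1) (Icc 0 a) := f.2
  have h := hf.continuousOn.domRestrict
  convert h using 1
  funext x
  exact (zeroExt_coe f.1 x).symm

theorem transferFun_eq_smul_of_hasEigenvector {m : ℕ} {r : ℝ} {u : CmSpace a ha m}
    (h : Module.End.HasEigenvector
      (transferOp ha m hB s : CmSpace a ha m →ₗ[ℝ] CmSpace a ha m) r u) :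
    transferFun hB s u.1 = r • u.1 :=
  congrArg Subtype.val h.apply_eq_smul

end PFOperator

/-! ### The main theorem -/

theorem mainTheorem7
    (γ : ℝ) (hγ : 1 ≤ γ)
    (B : Finset ℝ) (hBne : B.Nonempty) (hB : ∀ β ∈ B, γ ≤ β)
    (a : ℝ) (ha : 0 < a) (hγa : 1 / γ ≤ a)
    (m : ℕ) (hm : 1 ≤ m) (s : ℝ) (hs : 0 < s) :
    ∃ v : PFOperator.CmSpace a ha m,
      PFOperator.IsStrictlyPosEigenvector
        (PFOperator.transferOp ha m (PFOperator.Admissible.of_le hγ hB hγa) s) v ∧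
      PFOperator.IsNormalized v ∧
      (∀ u : PFOperator.CmSpace a ha m,
        PFOperator.IsStrictlyPosEigenvector
          (PFOperator.transferOp ha m (PFOperator.Admissible.of_le hγ hB hγa) s) u →
        ∃ c : ℝ, 0 < c ∧ u = c • v) ∧
      PFOperator.IsSmooth v ∧
      ∀ ν : ℕ, 1 ≤ ν → ∀ x : Set.Icc (0 : ℝ) a,
        0 ≤ (-1) ^ ν * (PFOperator.nthDeriv ν v x / v x) ∧
        (-1) ^ ν * (PFOperator.nthDeriv ν v x / v x) ≤
          (∏ i ∈ Finset.range ν, (2 * s + i)) / γ ^ ν := by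
  have hA := PFOperator.Admissible.of_le hγ hB hγa
  obtain ⟨r, W, hW, hW1, hTW⟩ := PFOperator.exists_eigenJet (s := s) hA ha hBne hs hγ hB
  set o : Icc (0 : ℝ) a := ⟨0, le_rfl, ha.le⟩ with ho
  have hWo : 0 < W 0 o := one_pos.trans_le hW1
  -- The eigenfunction is largest at `0`, so dividing by its value there makes the supremum `1`.
  obtain ⟨V, hVdef⟩ : ∃ V, V = (W 0 o)⁻¹ • W := ⟨_, rfl⟩
  have hV : PFOperator.JetBounds ha s γ V := hVdef ▸ hW.smul (by positivity)
  have hVo : V 0 o = 1 := by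
    simp [hVdef, hWo.ne']
  have hTV : PFOperator.transferFun hA s (V 0) = r • V 0 := by
    rw [hVdef, Pi.smul_apply, PFOperator.transferFun_smul, hTW, smul_comm]
  -- The Harnack bound turns nonnegativity into strict positivity.
  have hpos : ∀ x, 0 < V 0 x := fun x => by
    refine lt_of_lt_of_le ?_ (hV.lower x)
    rw [← ho, hVo]
    positivity
  have hVm : V 0 ∈ PFOperator.cmSubmodule a m :=
    hV.contDiffOn.of_le (by exact_mod_cast le_top)
  have hne : (⟨V 0, hVm⟩ : PFOperator.CmSpace a ha m) ≠ 0 := fun h => by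
    have := congrFun (congrArg Subtype.val h) o
    change V 0 o = 0 at this
    rw [hVo] at this
    exact one_ne_zero this
  refine ⟨⟨V 0, hVm⟩, ⟨⟨r, Module.End.hasEigenvector_iff.2
    ⟨Module.End.mem_eigenspace_iff.2 (Subtype.ext hTV), hne⟩⟩, hpos⟩, ?_, ?_, hV.contDiffOn, ?_⟩
  · refine IsGreatest.isLUB ⟨⟨o, hVo⟩, ?_⟩
    rintro _ ⟨x, rfl⟩
    exact (hV.upper x).trans_eq hVo
  · rintro u ⟨⟨ρ, hρ⟩, hu⟩
    obtain ⟨c, hc, h⟩ := PFOperator.eq_smul_of_positive_eigenfunctions hA ha hBne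
      (fun β hβ => hγ.trans (hB β hβ)) (PFOperator.CmSpace.continuous_coe u)
      (PFOperator.CmSpace.continuous_coe (ha := ha) (⟨V 0, hVm⟩ : PFOperator.CmSpace a ha m)) hu hpos
      (PFOperator.transferFun_eq_smul_of_hasEigenvector hA hρ) hTV
    exact ⟨c, hc, Subtype.ext h⟩
  · intro ν _ x
    have h1 : PFOperator.nthDeriv ν (V 0) x = V ν x :=
      (hV.iteratedDerivWithin_eqOn ν x.2).trans (PFOperator.zeroExt_coe _ x)
    change 0 ≤ (-1) ^ ν * (PFOperator.nthDeriv ν (V 0) x / V 0 x) ∧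
      (-1) ^ ν * (PFOperator.nthDeriv ν (V 0) x / V 0 x) ≤ PFOperator.derivConst s γ ν
    rw [h1, ← mul_div_assoc]
    exact ⟨div_nonneg (hV.sign ν x) (hpos x).le, (div_le_iff₀ (hpos x)).2 (hV.bound ν x)⟩
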